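/- A \emph{normal map} (crossed module) is a homomorphism of groups $n\colon M\to G$ together with an action of $G$ on $M$ by automorphisms such that $n({}^{g}m)=g\,n(m)\,g^{-1}$ and ${}^{n(m)}m'=m\,m'\,m^{-1}$ for all $g\in G$, $m,m'\in M$. The \emph{free normal closure} of a homomorphism $\varphi\colon\Gamma\to G$ is the universal factorization $\Gamma\xrightarrow{c_\varphi}\Gamma^{\varphi}\xrightarrow{\widetilde\varphi}G$ of $\varphi$ with $\widetilde\varphi$ a normal map: for every factorization $\Gamma\xrightarrow{\psi}M\xrightarrow{n}G$ of $\varphi$ with $n$ a normal map there is a unique $G$-equivariant homomorphism $f\colon\Gamma^\varphi\to M$ with $f\circ c_\varphi=\psi$ and $n\circ f=\widetilde\varphi$. The \emph{normal closures tower} of $\varphi$ is the tower $\cdots\to\Gamma_3\to\Gamma_2\to\Gamma_1=G$ with homomorphisms $\varphi_i\colon\Gamma\to\Gamma_i$ given by $\varphi_1=\varphi$, $\Gamma_{i+1}=\Gamma_i^{\varphi_i}$, $\varphi_{i+1}=c_{\varphi_i}$, and with $\widetilde{\varphi_i}\colon\Gamma_{i+1}\to\Gamma_i$ as its maps. Let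 $\Gamma_\infty=\varprojlim\Gamma_i$, and let $\varphi_\infty\colon\Gamma\to\Gamma_\infty$ be the homomorphism induced by the $\varphi_i$. For a group $H$ let $\gamma_1(H)=H$ and $\gamma_{k+1}(H)=[\gamma_k(H),H]$; if this series becomes constant after finitely many steps, $\gamma_\infty(H)$ denotes its terminal member. \textbf{Theorem.} Let $\varphi\colon\Gamma\to G$ be a homomorphism of groups. For every $k\ge 1$ the homomorphism $\Gamma/\gamma_k(\Gamma)\to\Gamma_\infty/\gamma_k(\Gamma_\infty)$ induced by $\varphi_\infty$ is injective. If $\Gamma$ and $G$ are finite, then this homomorphism is an isomorphism for every $k\ge 1$; moreover, the descending central series of $\Gamma$ and of $\Gamma_\infty$ terminate, and $\varphi_\infty$ induces an isomorphism $\Gamma/\gamma_\infty(\Gamma)\cong\Gamma_\infty/\gamma_\infty(\Gamma_\infty)$. -/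

import Mathlib

universe u v w

namespace SubnormalClosure

/-- A normal structure (crossed module structure) on a homomorphism `n : M → G`: an action of `G`
on `M` by automorphisms for which `n` is equivariant and which satisfies the Peiffer identity.
A normal map is a homomorphism together with such a structure. -/
structure NormalStructure {M : Type u} {G : Type v} [Group M] [Group G] (n : M →* G) where
  act : G →* MulAut M
  equivariant : ∀ (g : G) (m : M), n (act g m) = g * n m * g⁻¹
  peiffer : ∀ m m' : M, act (n m) m' = m * m' * m⁻¹

section FreeNormalClosure

variable {Γ : Type u} {G : Type v} [Group Γ] [Group G] (φ : Γ →* G)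

/-- The free product of copies `Γ_g` of `Γ`, one for each `g : G`. -/
abbrev Copies (Γ : Type u) (G : Type v) [Group Γ] : Type (max u v) :=
  Monoid.CoprodI (fun _ : G => Γ)

/-- The inclusion of the copy of `Γ` indexed by `g`. -/
def copy (Γ : Type u) {G : Type v} [Group Γ] (g : G) : Γ →* Copies Γ G :=
  Monoid.CoprodI.of (M := fun _ : G => Γ) (i := g)

/-- The homomorphism to `G` sending the element `x` of the copy `Γ_g` to `g φ(x) g⁻¹`. -/
def copiesMap : Copies Γ G →* G :=
  Monoid.CoprodI.lift fun g => (MulAut.conj g).toMonoidHom.comp φ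

/-- Left translation of the indices: `x` in the copy `Γ_g` goes to `x` in the copy `Γ_{hg}`. -/
def shift (Γ : Type u) {G : Type v} [Group Γ] [Group G] (h : G) : Copies Γ G →* Copies Γ G :=
  Monoid.CoprodI.lift fun g => copy Γ (h * g)

/-- The Peiffer subgroup: the normal subgroup generated by all `x y x⁻¹ (∂x • y)⁻¹`. -/
def peifferSubgroup : Subgroup (Copies Γ G) :=
  Subgroup.normalClosure
    {z | ∃ x y : Copies Γ G, z = x * y * x⁻¹ * (shift Γ (copiesMap φ x) y)⁻¹}

instance : (peifferSubgroup φ).Normal := Subgroup.normalClosure_normal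

/-- The free normal closure of `φ : Γ → G`, i.e. the free crossed module over `G` on `φ`. Its
universal property is `FreeNormalClosure.existsUnique_lift`. -/
def FreeNormalClosure : Type (max u v) := Copies Γ G ⧸ peifferSubgroup φ

instance : Group (FreeNormalClosure φ) :=
  inferInstanceAs (Group (Copies Γ G ⧸ peifferSubgroup φ))

@[simp]
theorem copiesMap_copy (g : G) (x : Γ) : copiesMap φ (copy Γ g x) = g * φ x * g⁻¹ := by
  simp [copiesMap, copy]

@[simp]
theorem shift_copy (h g : G) (x : Γ) : shift Γ h (copy Γ g x) = copy Γ (h * g) x := by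
  simp [shift, copy]

theorem copies_hom_ext {Γ : Type u} {G : Type v} [Group Γ] {H : Type w} [Group H] {f f' : Copies Γ G →* H}
    (h : ∀ g x, f (copy Γ g x) = f' (copy Γ g x)) : f = f' :=
  Monoid.CoprodI.ext_hom _ _ fun g => MonoidHom.ext fun x => h g x

theorem shift_one : shift Γ (1 : G) = MonoidHom.id _ :=
  copies_hom_ext fun g x => by simp

theorem shift_mul (a b : G) : shift Γ (a * b) = (shift Γ a).comp (shift Γ b) :=
  copies_hom_ext fun g x => by simp [mul_assoc]

theorem copiesMap_shift (h : G) (y : Copies Γ G) :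
    copiesMap φ (shift Γ h y) = h * copiesMap φ y * h⁻¹ := by
  have : (copiesMap φ).comp (shift Γ h) = (MulAut.conj h).toMonoidHom.comp (copiesMap φ) :=
    copies_hom_ext fun g x => by simp [mul_assoc]
  exact DFunLike.congr_fun this y

theorem peifferSubgroup_le_ker : peifferSubgroup φ ≤ (copiesMap φ).ker := by
  refine Subgroup.normalClosure_le_normal ?_
  rintro _ ⟨x, y, rfl⟩
  simp [MonoidHom.mem_ker, copiesMap_shift]

theorem peifferSubgroup_le_comap_shift (h : G) :
    peifferSubgroup φ ≤ (peifferSubgroup φ).comap (shift Γ h) := by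
  refine Subgroup.normalClosure_le_normal ?_
  rintro _ ⟨x, y, rfl⟩
  refine Subgroup.subset_normalClosure ⟨shift Γ h x, shift Γ h y, ?_⟩
  have e : shift Γ (copiesMap φ (shift Γ h x)) (shift Γ h y)
      = shift Γ h (shift Γ (copiesMap φ x) y) := by
    rw [copiesMap_shift, ← MonoidHom.comp_apply, ← MonoidHom.comp_apply, ← shift_mul, ← shift_mul]
    simp
  rw [e]
  simp

namespace FreeNormalClosure

/-- The canonical map `c_φ : Γ → Γ^φ`, the inclusion of the copy indexed by `1`. -/
def ofDomain : Γ →* FreeNormalClosure φ :=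
  (QuotientGroup.mk' (peifferSubgroup φ)).comp (copy Γ (1 : G))

/-- The canonical normal map `Γ^φ → G`. -/
def toCodomain : FreeNormalClosure φ →* G :=
  QuotientGroup.lift (peifferSubgroup φ) (copiesMap φ) (peifferSubgroup_le_ker φ)

theorem toCodomain_comp_ofDomain : (toCodomain φ).comp (ofDomain φ) = φ :=
  MonoidHom.ext fun x => by
    change copiesMap φ (copy Γ 1 x) = φ x
    simp

/-- The action of an element of `G` on `Γ^φ`. -/
def actHom (h : G) : FreeNormalClosure φ →* FreeNormalClosure φ :=
  QuotientGroup.map _ _ (shift Γ h) (peifferSubgroup_le_comap_shift φ h)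

theorem actHom_mk (h : G) (x : Copies Γ G) :
    actHom φ h (QuotientGroup.mk' (peifferSubgroup φ) x)
      = QuotientGroup.mk' (peifferSubgroup φ) (shift Γ h x) := rfl

theorem actHom_one : actHom φ 1 = MonoidHom.id _ := by
  ext x
  obtain ⟨x, rfl⟩ := QuotientGroup.mk'_surjective _ x
  rw [actHom_mk, shift_one]; rfl

theorem actHom_mul (a b : G) : actHom φ (a * b) = (actHom φ a).comp (actHom φ b) := by
  ext x
  obtain ⟨x, rfl⟩ := QuotientGroup.mk'_surjective _ x
  rw [actHom_mk, shift_mul]; rfl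

/-- The crossed module structure on `Γ^φ → G`. -/
def normalStructure : NormalStructure (toCodomain φ) where
  act :=
    { toFun := fun g => MonoidHom.toMulEquiv (actHom φ g) (actHom φ g⁻¹)
        (by rw [← actHom_mul, inv_mul_cancel, actHom_one])
        (by rw [← actHom_mul, mul_inv_cancel, actHom_one])
      map_one' := MulEquiv.ext fun x => DFunLike.congr_fun (actHom_one φ) x
      map_mul' := fun a b => MulEquiv.ext fun x => DFunLike.congr_fun (actHom_mul φ a b) x }
  equivariant := fun g m => by
    obtain ⟨x, rfl⟩ := QuotientGroup.mk'_surjective _ m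
    exact copiesMap_shift φ g x
  peiffer := fun m m' => by
    obtain ⟨x, rfl⟩ := QuotientGroup.mk'_surjective _ m
    obtain ⟨y, rfl⟩ := QuotientGroup.mk'_surjective _ m'
    have h : x * y * x⁻¹ * (shift Γ (copiesMap φ x) y)⁻¹ ∈ peifferSubgroup φ :=
      Subgroup.subset_normalClosure ⟨x, y, rfl⟩
    have h2 := (QuotientGroup.eq_one_iff _).2 h
    exact (mul_inv_eq_one.1 h2).symm

/-- `Γ → Γ^φ → G` is the universal factorization of `φ` through a normal map. -/
theorem existsUnique_lift {M : Type w} [Group M] (ψ : Γ →* M) (n : M →* G)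
    (S : NormalStructure n) (hφ : n.comp ψ = φ) :
    ∃! f : FreeNormalClosure φ →* M,
      f.comp (ofDomain φ) = ψ ∧ n.comp f = toCodomain φ ∧
        ∀ g x, f ((normalStructure φ).act g x) = S.act g (f x) := by
  let F : Copies Γ G →* M := Monoid.CoprodI.lift fun g => (S.act g).toMonoidHom.comp ψ
  have F_copy : ∀ g x, F (copy Γ g x) = S.act g (ψ x) := fun g x => by simp [F, copy]
  have nF : ∀ x, n (F x) = copiesMap φ x := fun x =>
    DFunLike.congr_fun (copies_hom_ext (f := n.comp F) (f' := copiesMap φ) fun g x => by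
      simp [F_copy, S.equivariant, ← hφ]) x
  have F_shift : ∀ h x, F (shift Γ h x) = S.act h (F x) := fun h x =>
    DFunLike.congr_fun (copies_hom_ext (f := F.comp (shift Γ h))
      (f' := (S.act h).toMonoidHom.comp F) fun g x => by simp [F_copy]) x
  have hF : peifferSubgroup φ ≤ F.ker := by
    refine Subgroup.normalClosure_le_normal ?_
    rintro _ ⟨x, y, rfl⟩
    simp [MonoidHom.mem_ker, F_shift, ← nF, S.peiffer]
  refine ⟨QuotientGroup.lift _ F hF, ⟨?_, ?_, ?_⟩, ?_⟩
  · ext x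
    exact (F_copy 1 x).trans (by simp)
  · ext x
    obtain ⟨x, rfl⟩ := QuotientGroup.mk'_surjective _ x
    exact nF x
  · intro g x
    obtain ⟨x, rfl⟩ := QuotientGroup.mk'_surjective _ x
    exact F_shift g x
  · rintro f ⟨h1, -, h3⟩
    have key : f.comp (QuotientGroup.mk' (peifferSubgroup φ)) = F := by
      refine copies_hom_ext fun g x => ?_
      have := h3 g (ofDomain φ x)
      rw [← MonoidHom.comp_apply f (ofDomain φ), h1] at this
      rw [F_copy, ← this]
      change f _ = f (QuotientGroup.mk' (peifferSubgroup φ) (shift Γ g (copy Γ 1 x)))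
      rw [shift_copy, mul_one]
      rfl
    ext x
    obtain ⟨x, rfl⟩ := QuotientGroup.mk'_surjective _ x
    exact DFunLike.congr_fun key x

end FreeNormalClosure

end FreeNormalClosure

section Tower

/-- A group equipped with a homomorphism from `Γ`. -/
structure GroupUnder (Γ : Type u) [Group Γ] where
  carrier : Type u
  [group : Group carrier]
  hom : Γ →* carrier

attribute [instance] GroupUnder.group

variable {Γ G : Type u} [Group Γ] [Group G] (φ : Γ →* G)

/-- The normal closures tower of `φ`, indexed from `0`: `tower φ i` is `φ_{i+1} : Γ → Γ_{i+1}`,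
so that `tower φ 0` is `φ : Γ → G`. -/
def tower : ℕ → GroupUnder Γ
  | 0 => ⟨G, φ⟩
  | i + 1 => ⟨FreeNormalClosure (tower i).hom, FreeNormalClosure.ofDomain (tower i).hom⟩

/-- The normal map from each term of the tower to the preceding one. -/
def towerMap (i : ℕ) : (tower φ (i + 1)).carrier →* (tower φ i).carrier :=
  FreeNormalClosure.toCodomain (tower φ i).hom

theorem towerMap_hom (i : ℕ) (x : Γ) :
    towerMap φ i ((tower φ (i + 1)).hom x) = (tower φ i).hom x :=
  DFunLike.congr_fun (FreeNormalClosure.toCodomain_comp_ofDomain (tower φ i).hom) x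

/-- The compatible sequences in the product of the terms of the tower. -/
def towerLimit : Subgroup (∀ i, (tower φ i).carrier) where
  carrier := {x | ∀ i, towerMap φ i (x (i + 1)) = x i}
  mul_mem' := fun {x y} hx hy i => by
    rw [Pi.mul_apply, map_mul, hx i, hy i, Pi.mul_apply]
  one_mem' := fun i => map_one (towerMap φ i)
  inv_mem' := fun {x} hx i => by
    rw [Pi.inv_apply, map_inv, hx i, Pi.inv_apply]

/-- `Γ_∞`, the inverse limit of the normal closures tower of `φ`. -/
abbrev GammaInfty : Type u := towerLimit φ

/-- The natural map `φ_∞ : Γ → Γ_∞`. -/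
def homInfty : Γ →* GammaInfty φ :=
  (MonoidHom.pi fun i => (tower φ i).hom).codRestrict (towerLimit φ)
    fun x i => towerMap_hom φ i x

end Tower

section LowerCentralSeries

/-- `γ_k(H)` with the convention `γ_1(H) = H` (only used for `k ≥ 1`); Mathlib's series
starts at `0`. -/
def gammaSeries (H : Type u) [Group H] (k : ℕ) : Subgroup H :=
  (⊤ : Subgroup H).lowerCentralSeries (k - 1)

/-- The descending central series of `H` terminates at `T`. -/
def GammaTerminatesAt (H : Type u) [Group H] (T : Subgroup H) : Prop :=
  ∃ t, 1 ≤ t ∧ ∀ s, t ≤ s → gammaSeries H s = T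

/-- `γ_∞(H)`: the terminal member of the descending central series, if it terminates
(see `GammaTerminatesAt.eq_gammaResidual`). -/
def gammaResidual (H : Type u) [Group H] : Subgroup H := ⨅ k, gammaSeries H k

theorem GammaTerminatesAt.eq_gammaResidual {H : Type u} [Group H] {T : Subgroup H}
    (h : GammaTerminatesAt H T) : gammaResidual H = T := by
  obtain ⟨t, -, ht⟩ := h
  refine le_antisymm ((iInf_le _ t).trans (ht t le_rfl).le) (le_iInf fun k => ?_)
  rw [← ht (max t k) (le_max_left _ _)]
  exact Subgroup.lowerCentralSeries_antitone _ (Nat.sub_le_sub_right (le_max_right t k) 1)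

instance (H : Type u) [Group H] (k : ℕ) : (gammaSeries H k).Normal := by
  unfold gammaSeries; infer_instance

instance (H : Type u) [Group H] : (gammaResidual H).Normal :=
  Subgroup.normal_iInf_normal fun _ => inferInstance

variable {A : Type u} {B : Type v} [Group A] [Group B] (f : A →* B)

theorem gammaSeries_le_comap (k : ℕ) : gammaSeries A k ≤ (gammaSeries B k).comap f := by
  unfold gammaSeries
  induction k - 1 with
  | zero => simp
  | succ n ih =>
    rw [← Subgroup.map_le_iff_le_comap] at ih ⊢
    rw [Subgroup.lowerCentralSeries_succ, Subgroup.lowerCentralSeries_succ,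
      Subgroup.map_commutator]
    exact Subgroup.commutator_mono ih le_top

theorem gammaResidual_le_comap : gammaResidual A ≤ (gammaResidual B).comap f := by
  unfold gammaResidual
  rw [Subgroup.comap_iInf]
  exact iInf_mono fun k => gammaSeries_le_comap f k

/-- The homomorphism `A/γ_k(A) → B/γ_k(B)` induced by `f : A → B`. -/
def gammaQuotientMap (k : ℕ) : A ⧸ gammaSeries A k →* B ⧸ gammaSeries B k :=
  QuotientGroup.map _ _ f (gammaSeries_le_comap f k)

/-- The homomorphism `A/γ_∞(A) → B/γ_∞(B)` induced by `f : A → B`. -/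
def gammaResidualQuotientMap : A ⧸ gammaResidual A →* B ⧸ gammaResidual B :=
  QuotientGroup.map _ _ f (gammaResidual_le_comap f)

end LowerCentralSeries

end SubnormalClosure

/-! Write `K` for the limit and `H` for the image of `Γ` in it. Injectivity: conjugation makes each
`Γ/γ_{i+1} → Γ/γ_i` a crossed module, so the universal property maps the tower, level by level and
under `Γ`, to the tower of nilpotent quotients (`exists_tower_lift`). An element of `Γ` that falls
into `γ_k(K)` therefore dies in `Γ/γ_k`. Surjectivity for finite groups reduces to `K = H[K,K]`,
since generation modulo commutators implies generation modulo every `γ_k`. All terms of the tower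
are finite, so `K` is profinite. The kernels `U_i` of its projections form a central filtration,
because a crossed module has central kernel. Since `gφ(x)g⁻¹ = [g,φ(x)]φ(x)`, each transition map
lands in the image of `Γ` times commutators, and compactness gives `K = H[K,K]U_i` for all `i`. The
difficulty is that `[K,K]` is not known to be closed. Put `P = ⋂ γ_i(K)U_i`. Then `K = PH`, and `P`
commutes with `U_0`, so `[P,P]` is finite. Consequently `[P,K]` lies in a closed subgroup `Y` of
`[K,K]`, and approximation modulo the `U_i` yields `P ≤ Y`, whence `K = H[K,K]`. -/

namespace SubnormalClosure

open scoped commutatorElement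

/-! ### Commutator calculus in abstract groups. -/

section Auxiliary

theorem exists_forall_ge_eq_of_antitone {α : Type*} [PartialOrder α] [Finite α] {f : ℕ → α}
    (hf : Antitone f) : ∃ n, ∀ m, n ≤ m → f m = f n := by
  obtain ⟨n, hn⟩ := WellFoundedGT.monotone_chain_condition
    (⟨fun i => OrderDual.toDual (f i), fun _ _ h => hf h⟩ : ℕ →o αᵒᵈ)
  exact ⟨n, fun m hm => (OrderDual.toDual.injective (hn m hm)).symm⟩

/-- A group with central kernel over a finite group has finitely many commutators. -/
theorem finite_commutatorSet_of_ker_le_center {M : Type*} {Q : Type*} [Group M] [Group Q] [Finite Q]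
    (f : M →* Q) (hf : f.ker ≤ Subgroup.center M) : Finite (commutatorSet M) := by
  have key : ∀ a b : M, f a = f b → ∃ z ∈ Subgroup.center M, a = b * z := fun a b h =>
    ⟨b⁻¹ * a, hf (by simp [MonoidHom.mem_ker, h]), by group⟩
  -- A commutator is unchanged when its entries are multiplied by central elements, so chosen lifts
  -- of the images already produce every commutator.
  let F : f.range × f.range → M := fun p => ⁅p.1.2.choose, p.2.2.choose⁆
  refine Set.Finite.subset (Set.finite_range F) ?_
  rintro _ ⟨a, b, rfl⟩
  refine ⟨(⟨f a, a, rfl⟩, ⟨f b, b, rfl⟩), ?_⟩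
  have h1 : f (⟨f a, a, rfl⟩ : f.range).2.choose = f a := (⟨f a, a, rfl⟩ : f.range).2.choose_spec
  have h2 : f (⟨f b, b, rfl⟩ : f.range).2.choose = f b := (⟨f b, b, rfl⟩ : f.range).2.choose_spec
  obtain ⟨z, hz, e⟩ := key _ _ h1
  obtain ⟨y, hy, e'⟩ := key _ _ h2
  change ⁅_, _⁆ = _
  rw [e, e']
  rw [Subgroup.mem_center_iff] at hz hy
  have hz' := fun g => (hz g).symm
  have hy' := fun g => (hy g).symm
  simp only [commutatorElement_def, mul_inv_rev]
  calc a * z * (b * y) * (z⁻¹ * a⁻¹) * (y⁻¹ * b⁻¹)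
      = a * (z * (b * y)) * z⁻¹ * a⁻¹ * y⁻¹ * b⁻¹ := by group
    _ = a * b * (y * a⁻¹) * y⁻¹ * b⁻¹ := by rw [hz' (b * y)]; group
    _ = a * b * a⁻¹ * b⁻¹ := by rw [hy' a⁻¹]; group

/-- The three subgroups lemma modulo a normal subgroup. -/
theorem commutator_commutator_le_of_rotate {K : Type*} [Group K] {A B C N : Subgroup K} [N.Normal]
    (h1 : ⁅⁅B, C⁆, A⁆ ≤ N) (h2 : ⁅⁅C, A⁆, B⁆ ≤ N) : ⁅⁅A, B⁆, C⁆ ≤ N := by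
  have e : ∀ X : Subgroup K, X ≤ N ↔ X.map (QuotientGroup.mk' N) = ⊥ := fun X => by
    rw [Subgroup.map_eq_bot_iff, QuotientGroup.ker_mk']
  rw [e] at h1 h2 ⊢
  simp only [Subgroup.map_commutator] at h1 h2 ⊢
  exact Subgroup.commutator_commutator_eq_bot_of_rotate h1 h2

/-- A subgroup that generates a group modulo its commutator subgroup generates it modulo every
term of the lower central series. -/
theorem sup_lowerCentralSeries_eq_top {K : Type*} [Group K] {H : Subgroup K}
    (h : H ⊔ commutator K = ⊤) (k : ℕ) : H ⊔ (⊤ : Subgroup K).lowerCentralSeries k = ⊤ := by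
  induction k with
  | zero => simp
  | succ k ih =>
    rcases k with _ | k
    · exact h
    set Z := (⊤ : Subgroup K).lowerCentralSeries (k + 1)
    set N := (⊤ : Subgroup K).lowerCentralSeries (k + 1 + 1) with hN
    have hZN : ∀ z ∈ Z, ∀ g, ⁅z, g⁆ ∈ N := fun z hz g =>
      Subgroup.commutator_mem_commutator hz (Subgroup.mem_top g)
    let q := QuotientGroup.mk' N
    have hcomm : ∀ z ∈ Z, ∀ g, q z * g = g * q z := fun z hz g => by
      obtain ⟨g, rfl⟩ := QuotientGroup.mk'_surjective N g
      rw [← commutatorElement_eq_one_iff_mul_comm, ← map_commutatorElement]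
      exact (QuotientGroup.eq_one_iff _).2 (hZN z hz g)
    have hdec : ∀ g : K, ∃ x ∈ H, ∃ z ∈ Z, x * z = g := fun g =>
      Subgroup.mem_sup_of_normal_right.1 (ih ▸ Subgroup.mem_top g)
    -- `K = HZ` with `Z` central modulo `N`, so modulo `N` every commutator of `K` is a commutator
    -- of elements of `H`.
    have hc : commutator K ≤ H ⊔ N := by
      rw [commutator_def, Subgroup.commutator_le]
      intro a _ b _
      obtain ⟨x, hx, z, hz, rfl⟩ := hdec a
      obtain ⟨y, hy, t, ht, rfl⟩ := hdec b
      have e : q ⁅x * z, y * t⁆ = q ⁅x, y⁆ := by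
        simp only [commutatorElement_def, mul_inv_rev, map_mul, map_inv]
        have e1 : q z * (q y * q t) = q y * q t * q z := hcomm z hz _
        have e2 : q t * (q x)⁻¹ = (q x)⁻¹ * q t := hcomm t ht _
        calc q x * q z * (q y * q t) * ((q z)⁻¹ * (q x)⁻¹) * ((q t)⁻¹ * (q y)⁻¹)
            = q x * (q z * (q y * q t)) * (q z)⁻¹ * (q x)⁻¹ * (q t)⁻¹ * (q y)⁻¹ := by group
          _ = q x * q y * (q t * (q x)⁻¹) * (q t)⁻¹ * (q y)⁻¹ := by rw [e1]; group
          _ = _ := by rw [e2]; group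
      have e3 : ⁅x, y⁆⁻¹ * ⁅x * z, y * t⁆ ∈ N := QuotientGroup.eq.1 e.symm
      rw [← mul_inv_cancel_left ⁅x, y⁆ ⁅x * z, y * t⁆]
      refine Subgroup.mul_mem_sup ?_ e3
      exact H.mul_mem (H.mul_mem (H.mul_mem hx hy) (H.inv_mem hx)) (H.inv_mem hy)
    exact top_le_iff.1 (h ▸ sup_le le_sup_left hc)

end Auxiliary

/-! ### Compact groups with a central filtration. -/

section Compact

variable {K : Type*} [Group K] [TopologicalSpace K] [IsTopologicalGroup K] [CompactSpace K]

/-- The sets `C ∩ xW_i` are nested, nonempty and compact. This passes from approximation modulo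
every `W_i` to approximation modulo their intersection. -/
theorem exists_mem_forall_inv_mul_mem {C : Set K} (hC : IsClosed C) {W : ℕ → Subgroup K}
    (hW : Antitone W) (hWc : ∀ i, IsClosed (W i : Set K)) {x : K}
    (h : ∀ i, ∃ c ∈ C, c⁻¹ * x ∈ W i) : ∃ c ∈ C, ∀ i, c⁻¹ * x ∈ W i := by
  let S : ℕ → Set K := fun i => C ∩ (fun c => c⁻¹ * x) ⁻¹' (W i : Set K)
  have hS : ∀ i, IsClosed (S i) := fun i => hC.inter ((hWc i).preimage (by fun_prop))
  obtain ⟨c, hc⟩ := IsCompact.nonempty_iInter_of_sequence_nonempty_isCompact_isClosed S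
    (fun i => Set.inter_subset_inter_right _ (Set.preimage_mono (hW i.le_succ)))
    (fun i => (h i).imp fun c hc => hc) (hS 0).isCompact hS
  rw [Set.mem_iInter] at hc
  exact ⟨c, (hc 0).1, fun i => (hc i).2⟩

/-- Induction on `k` by the three subgroups lemma: each commutation with `K` moves one step down the
filtration. -/
theorem commutator_lowerCentralSeries_le {K : Type*} [Group K] {U : ℕ → Subgroup K}
    (hN : ∀ i, (U i).Normal) (hU : ∀ i, ⁅U i, ⊤⁆ ≤ U (i + 1)) (k : ℕ) :
    ∀ j, ⁅(⊤ : Subgroup K).lowerCentralSeries k, U j⁆ ≤ U (j + k + 1) := by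
  induction k with
  | zero => intro j; rw [Subgroup.commutator_comm]; exact hU j
  | succ k ih =>
    intro j
    have := hN (j + (k + 1) + 1)
    rw [Subgroup.lowerCentralSeries_succ]
    refine commutator_commutator_le_of_rotate ?_ ?_
    · rw [Subgroup.commutator_comm]
      refine (Subgroup.commutator_mono le_rfl ?_).trans (((ih (j + 1))).trans_eq ?_)
      · rw [Subgroup.commutator_comm]; exact hU j
      · congr 1; omega
    · refine (Subgroup.commutator_mono ?_ le_rfl).trans (hU _)
      rw [Subgroup.commutator_comm]; exact ih j

/-- If `H` is a finite subgroup and `P` a closed normal subgroup with finite commutator subgroup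
such that `K = PH`, then `[P, K]` is contained in a closed subgroup of `P ∩ [K, K]`. -/
theorem exists_isClosed_commutator_le [T2Space K] (H P : Subgroup K) [Finite H] [P.Normal]
    (hP : IsClosed (P : Set K)) [Finite (commutator P)] (hPH : ∀ g : K, ∃ p ∈ P, ∃ h ∈ H, p * h = g) :
    ∃ Y : Subgroup K, IsClosed (Y : Set K) ∧ ⁅P, ⊤⁆ ≤ Y ∧ Y ≤ commutator K := by
  classical
  have : CompactSpace P := isCompact_iff_compactSpace.1 hP.isCompact
  have := Fintype.ofFinite H
  -- Being finite, `[P,P]` is closed, so the Hausdorff abelianization of `P` is the algebraic one.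
  have hcl : (commutator P).topologicalClosure = commutator P :=
    le_antisymm (Subgroup.topologicalClosure_minimal _ le_rfl (Set.toFinite _).isClosed)
      (Subgroup.le_topologicalClosure _)
  have : IsClosed ((commutator P).topologicalClosure : Set P) :=
    Subgroup.isClosed_topologicalClosure _
  let π : P →* TopologicalAbelianization P := QuotientGroup.mk' _
  have hπc : Continuous π := continuous_quotient_mk'
  have hπ : ∀ p : P, π p = 1 ↔ p ∈ commutator P := fun p => by
    exact (QuotientGroup.eq_one_iff _).trans (by rw [hcl])
  have hmem : ∀ (p : P) (h : K), ⁅(p : K), h⁆ ∈ P := fun p h =>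
    Subgroup.commutator_le_left P ⊤ (Subgroup.commutator_mem_commutator p.2 (Subgroup.mem_top h))
  -- `[pq,h] = p[q,h]p⁻¹[p,h]`, so `p ↦ [p,h]` becomes multiplicative modulo `[P,P]`.
  let e : H → P →* TopologicalAbelianization P := fun h =>
    { toFun := fun p => π ⟨⁅(p : K), (h : K)⁆, hmem p h⟩
      map_one' := (hπ _).2 (by
        have : (⟨⁅((1 : P) : K), (h : K)⁆, hmem 1 h⟩ : P) = 1 := Subtype.ext (by simp)
        rw [this]; exact one_mem _)
      map_mul' := fun p q => by
        have : (⟨⁅((p * q : P) : K), (h : K)⁆, hmem (p * q) h⟩ : P)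
            = p * ⟨⁅(q : K), (h : K)⁆, hmem q h⟩ * p⁻¹ * ⟨⁅(p : K), (h : K)⁆, hmem p h⟩ :=
          Subtype.ext (by simp [commutatorElement_def, mul_assoc])
        rw [this, map_mul, map_mul, map_mul, mul_comm (π p), map_inv, mul_inv_cancel_right,
          mul_comm] }
  have hec : ∀ h, Continuous (e h) := fun h => hπc.comp
    (Continuous.subtype_mk (by simp only [commutatorElement_def]; fun_prop) _)
  let E : (H → P) →* TopologicalAbelianization P :=
    { toFun := fun f => ∏ h, e h (f h)
      map_one' := by simp
      map_mul' := fun f g => by simp [Finset.prod_mul_distrib] }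
  have hEc : Continuous E := continuous_finsetProd _ fun h _ => (hec h).comp (continuous_apply h)
  have hEr : IsClosed (E.range : Set (TopologicalAbelianization P)) := by
    rw [MonoidHom.coe_range]; exact (isCompact_range hEc).isClosed
  -- Since `H` is finite, the products `∏ [p_h,h]` form a compact subgroup of the abelianization;
  -- `Y` is its preimage in `P`.
  refine ⟨(E.range.comap π).map P.subtype, ?_, ?_, ?_⟩
  · exact hP.isClosedEmbedding_subtypeVal.isClosedMap _ (hEr.preimage hπc)
  · rw [Subgroup.commutator_le]
    intro p hp g _
    obtain ⟨p', hp', h, hh, rfl⟩ := hPH g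
    refine ⟨⟨_, hmem ⟨p, hp⟩ (p' * h)⟩, ⟨Pi.mulSingle (M := fun _ => P) ⟨h, hh⟩ ⟨p, hp⟩, ?_⟩, rfl⟩
    have h1 : E (Pi.mulSingle (M := fun _ => P) ⟨h, hh⟩ ⟨p, hp⟩) = e ⟨h, hh⟩ ⟨p, hp⟩ := by
      change ∏ _, _ = _
      rw [Finset.prod_eq_single ⟨h, hh⟩]
      · simp
      · intro b _ hb
        rw [Pi.mulSingle_eq_of_ne hb, map_one]
      · simp
    -- Modulo `[P,P]` this reduces `[p,p'h]` to `[p,h]`.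
    have h2 : (⟨⁅p, p' * h⁆, hmem ⟨p, hp⟩ (p' * h)⟩ : P)
        = ⁅(⟨p, hp⟩ : P), ⟨p', hp'⟩⁆ * (⟨p', hp'⟩ * ⟨⁅p, h⁆, hmem ⟨p, hp⟩ h⟩ * ⟨p', hp'⟩⁻¹) :=
      Subtype.ext (by simp [commutatorElement_def, mul_assoc])
    have h3 : π ⁅(⟨p, hp⟩ : P), ⟨p', hp'⟩⁆ = 1 := (hπ _).2
      (Subgroup.commutator_mem_commutator (Subgroup.mem_top _) (Subgroup.mem_top _))
    rw [h1, h2, map_mul, h3, one_mul, map_mul, map_mul, mul_comm (π _), map_inv,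
      mul_inv_cancel_right]
    rfl
  · have hr : E.range ≤ ((commutator K).subgroupOf P).map π := by
      rintro _ ⟨f, rfl⟩
      refine Subgroup.prod_mem _ fun h _ => ⟨_, ?_, rfl⟩
      exact Subgroup.commutator_mem_commutator (Subgroup.mem_top _) (Subgroup.mem_top _)
    rintro _ ⟨p, hp, rfl⟩
    obtain ⟨r, hr, e⟩ := hr hp
    have h1 : r⁻¹ * p ∈ commutator P := (hπ _).1 (by rw [map_mul, map_inv, e, inv_mul_cancel])
    have h2 : ((r⁻¹ * p : P) : K) ∈ commutator K := by
      have : (commutator P).map P.subtype ≤ commutator K := by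
        rw [Subgroup.map_subtype_commutator]
        exact Subgroup.commutator_mono le_top le_top
      exact this ⟨_, h1, rfl⟩
    have := (commutator K).mul_mem hr h2
    simpa using this

/-- A compact group with a descending central filtration by open normal subgroups is generated
by a finite subgroup `H` and its commutator subgroup as soon as this holds modulo each term. -/
theorem sup_commutator_eq_top_of_compactSpace [T2Space K] (H : Subgroup K) [Finite H]
    {U : ℕ → Subgroup K} (hN : ∀ i, (U i).Normal) (hopen : ∀ i, IsOpen (U i : Set K))
    (hanti : Antitone U) (hU : ∀ i, ⁅U i, ⊤⁆ ≤ U (i + 1)) (hbot : ⨅ i, U i = ⊥)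
    (hH : ∀ i, H ⊔ commutator K ⊔ U i = ⊤) : H ⊔ commutator K = ⊤ := by
  set γ := (⊤ : Subgroup K).lowerCentralSeries
  have hγ : Antitone γ := Subgroup.lowerCentralSeries_antitone _
  have hUc : ∀ i, IsClosed (U i : Set K) := fun i => Subgroup.isClosed_of_isOpen _ (hopen i)
  let W : ℕ → Subgroup K := fun i => γ i ⊔ U i
  have hWN : ∀ i, (W i).Normal := fun i => inferInstance
  have hW : Antitone W := fun i j h => sup_le_sup (hγ h) (hanti h)
  have hWc : ∀ i, IsClosed (W i : Set K) := fun i =>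
    Subgroup.isClosed_of_isOpen _ (Subgroup.isOpen_mono le_sup_right (hopen i))
  let P : Subgroup K := ⨅ i, W i
  have hPmem : ∀ {x}, x ∈ P ↔ ∀ i, x ∈ W i := Subgroup.mem_iInf
  have hPN : P.Normal := Subgroup.normal_iInf_normal hWN
  have hPc : IsClosed (P : Set K) := by
    rw [Subgroup.coe_iInf]; exact isClosed_iInter hWc
  have hHP : ∀ g : K, ∃ h ∈ H, h⁻¹ * g ∈ P := fun g => by
    obtain ⟨c, hc, h⟩ := exists_mem_forall_inv_mul_mem (C := H) (Set.toFinite _).isClosed hW hWc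
      (x := g) fun i => by
        have h1 : (H ⊔ U i) ⊔ γ i = ⊤ := sup_lowerCentralSeries_eq_top (by
          rw [sup_right_comm]; exact hH i) i
        rw [sup_assoc, sup_comm (U i)] at h1
        obtain ⟨h, hh, w, hw, e⟩ := (Subgroup.mem_sup_of_normal_right (t := γ i ⊔ U i)).1
          (h1 ▸ Subgroup.mem_top g)
        exact ⟨h, hh, by rw [← e, inv_mul_cancel_left]; exact hw⟩
    exact ⟨c, hc, hPmem.2 h⟩
  have hPH : ∀ g : K, ∃ p ∈ P, ∃ h ∈ H, p * h = g := fun g => by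
    obtain ⟨h, hh, hp⟩ := hHP g⁻¹
    exact ⟨(h⁻¹ * g⁻¹)⁻¹, P.inv_mem hp, h⁻¹, H.inv_mem hh, by group⟩
  -- For each `i`, write `p = cv` with `c` in `γ i` and `v` in `U i`; both `[c,u]` and `[v,u]` lie
  -- in `U i`.
  have hcent : ∀ p ∈ P, ∀ u ∈ U 0, ⁅p, u⁆ = 1 := fun p hp u hu => by
    rw [← Subgroup.mem_bot, ← hbot, Subgroup.mem_iInf]
    intro i
    obtain ⟨c, hc, v, hv, rfl⟩ := Subgroup.mem_sup_of_normal_right.1 (hPmem.1 hp i)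
    rw [commutatorElement_mul_left_eq_conj_mul]
    refine (U i).mul_mem ((hN i).conj_mem _ ?_ _) ?_
    · exact Subgroup.commutator_le_left _ ⊤
        (Subgroup.commutator_mem_commutator hv (Subgroup.mem_top u))
    · exact hanti (by omega) (commutator_lowerCentralSeries_le hN hU i 0
        (Subgroup.commutator_mem_commutator hc hu))
  have hfin : ∀ i, Finite (K ⧸ U i) := fun i => Subgroup.quotient_finite_of_isOpen _ (hopen i)
  have : Finite (commutatorSet P) := by
    refine finite_commutatorSet_of_ker_le_center
      ((QuotientGroup.mk' (U 0)).comp P.subtype) fun p hp => ?_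
    have hp : (p : K) ∈ U 0 := (QuotientGroup.eq_one_iff _).1 hp
    rw [Subgroup.mem_center_iff]
    intro q
    exact Subtype.ext (commutatorElement_eq_one_iff_mul_comm.1 (hcent q q.2 p hp))
  obtain ⟨Y, hYc, hPY, hY⟩ := exists_isClosed_commutator_le H P hPc hPH
  -- In the finite quotient `K/U_i` the lower central series stabilizes, say at `γ n`. Compactness
  -- gives `γ n ≤ U_i P`, so `γ (n+1) ≤ [P,K]U_i ≤ YU_i`, while `P ≤ γ (n+1) U_i`.
  have hPU : ∀ i, P ≤ Y ⊔ U i := fun i => by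
    obtain ⟨n, hn⟩ := exists_forall_ge_eq_of_antitone
      (f := fun j => (γ j).map (QuotientGroup.mk' (U i))) fun a b h => Subgroup.map_mono (hγ h)
    have hn' : ∀ j, n ≤ j → γ j ⊔ U i = γ n ⊔ U i := fun j hj => by
      have := congrArg (Subgroup.comap (QuotientGroup.mk' (U i))) (hn j hj)
      simpa only [Subgroup.comap_map_eq, QuotientGroup.ker_mk'] using this
    have h1 : ∀ x ∈ γ n, ∃ u ∈ U i, u⁻¹ * x ∈ P := fun x hx => by
      obtain ⟨u, hu, h⟩ := exists_mem_forall_inv_mul_mem (hUc i) hW hWc (x := x) fun j => by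
        have : x ∈ γ (max n j) ⊔ U i := by
          rw [hn' _ (le_max_left _ _)]; exact Subgroup.mem_sup_left hx
        rw [sup_comm] at this
        obtain ⟨u, hu, w, hw, e⟩ := Subgroup.mem_sup_of_normal_right.1 this
        exact ⟨u, hu, by
          rw [← e, inv_mul_cancel_left]
          exact Subgroup.mem_sup_left (hγ (le_max_right n j) hw)⟩
      exact ⟨u, hu, hPmem.2 h⟩
    have h2 : γ (n + 1) ≤ ⁅P, ⊤⁆ ⊔ U i := by
      change ⁅γ n, ⊤⁆ ≤ _
      rw [Subgroup.commutator_le]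
      intro x hx g hg
      obtain ⟨u, hu, hp⟩ := h1 x hx
      rw [← mul_inv_cancel_left u x, commutatorElement_mul_left_eq_conj_mul]
      refine Subgroup.mul_mem _ (Subgroup.mem_sup_left ?_) (Subgroup.mem_sup_right ?_)
      · exact Subgroup.Normal.conj_mem inferInstance _
          (Subgroup.commutator_mem_commutator hp hg) _
      · exact Subgroup.commutator_le_left _ ⊤ (Subgroup.commutator_mem_commutator hu hg)
    intro x hx
    have h3 : x ∈ γ (n + 1) ⊔ U i :=
      sup_le_sup (hγ (le_max_left _ _)) (hanti (le_max_right _ _)) (hPmem.1 hx (max (n + 1) i))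
    exact (sup_le (h2.trans (sup_le_sup_right hPY _)) le_sup_right) h3
  have hPY' : P ≤ Y := fun x hx => by
    obtain ⟨c, hc, h⟩ := exists_mem_forall_inv_mul_mem hYc hanti hUc (x := x) fun i => by
      obtain ⟨y, hy, u, hu, e⟩ := Subgroup.mem_sup_of_normal_right.1 (hPU i hx)
      exact ⟨y, hy, by rw [← e, inv_mul_cancel_left]; exact hu⟩
    have : c⁻¹ * x ∈ (⊥ : Subgroup K) := hbot ▸ Subgroup.mem_iInf.2 h
    rw [Subgroup.mem_bot, inv_mul_eq_one] at this
    exact this ▸ hc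
  refine top_le_iff.1 fun g _ => ?_
  obtain ⟨h, hh, hp⟩ := hHP g
  rw [← mul_inv_cancel_left h g]
  exact Subgroup.mul_mem_sup hh (hY (hPY' hp))

end Compact

/-! ### Inverse sequences of finite groups. -/

section InverseSequence

variable {X : ℕ → Type*} [∀ i, Group (X i)] (p : ∀ i, X (i + 1) →* X i)

/-- The sequences that are compatible up to the index `j`. -/
def compatibleUpTo (j : ℕ) : Subgroup (∀ i, X i) where
  carrier := {x | ∀ i, i < j → p i (x (i + 1)) = x i}
  mul_mem' := fun {x y} hx hy i hi => by
    rw [Pi.mul_apply, map_mul, hx i hi, hy i hi, Pi.mul_apply]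
  one_mem' := fun i _ => map_one (p i)
  inv_mem' := fun {x} hx i hi => by
    rw [Pi.inv_apply, map_inv, hx i hi, Pi.inv_apply]

theorem compatibleUpTo_antitone : Antitone (compatibleUpTo p) :=
  fun _ _ h _ hx i hi => hx i (hi.trans_le h)

theorem eq_of_mem_compatibleUpTo {j : ℕ} {x y : ∀ i, X i} (hx : x ∈ compatibleUpTo p j)
    (hy : y ∈ compatibleUpTo p j) (h : x j = y j) {i : ℕ} (hi : i ≤ j) : x i = y i := by
  induction j with
  | zero => obtain rfl := Nat.le_zero.1 hi; exact h
  | succ j ih =>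
    rcases hi.lt_or_eq with hi | rfl
    · refine ih (compatibleUpTo_antitone p j.le_succ hx) (compatibleUpTo_antitone p j.le_succ hy)
        ?_ (Nat.lt_succ_iff.1 hi)
      rw [← hx j j.lt_succ_self, ← hy j j.lt_succ_self, h]
    · exact h

theorem exists_mem_compatibleUpTo (j : ℕ) (t : X j) : ∃ x ∈ compatibleUpTo p j, x j = t := by
  induction j with
  | zero => exact ⟨Function.update 1 0 t, fun i hi => absurd hi (by omega), by simp⟩
  | succ j ih =>
    obtain ⟨x, hx, e⟩ := ih (p j t)
    refine ⟨Function.update x (j + 1) t, fun i hi => ?_, by simp⟩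
    rcases (Nat.lt_succ_iff.1 hi).lt_or_eq with hi | rfl
    · rw [Function.update_of_ne (by omega), Function.update_of_ne (by omega)]
      exact hx i hi
    · rw [Function.update_self, Function.update_of_ne (by omega), e]

/-- In an inverse sequence of finite groups, the image of the limit in a term is the image of
all sufficiently late terms. -/
theorem exists_map_compatibleUpTo_eq [∀ i, Finite (X i)] {L : Subgroup (∀ i, X i)}
    (hL : ∀ x, x ∈ L ↔ ∀ i, p i (x (i + 1)) = x i) (i : ℕ) :
    ∃ n, ∀ j, n ≤ j → (compatibleUpTo p j).map (Pi.evalMonoidHom X i)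
      = L.map (Pi.evalMonoidHom X i) := by
  obtain ⟨n, hn⟩ := exists_forall_ge_eq_of_antitone
    (f := fun j => (compatibleUpTo p j).map (Pi.evalMonoidHom X i))
    fun a b h => Subgroup.map_mono (compatibleUpTo_antitone p h)
  refine ⟨n, fun j hj => le_antisymm ?_ (Subgroup.map_mono fun x hx l _ => (hL x).1 hx l)⟩
  rw [hn j hj]
  intro g hg
  let _ : ∀ i, TopologicalSpace (X i) := fun _ => ⊥
  have : ∀ i, DiscreteTopology (X i) := fun _ => ⟨rfl⟩
  -- A common point of these nested nonempty compact sets is a fully compatible sequence through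
  -- `g`.
  let S : ℕ → Set (∀ i, X i) := fun j => {x | x ∈ compatibleUpTo p j ∧ x i = g}
  have hS : ∀ j, IsClosed (S j) := fun j => by
    refine IsClosed.inter ?_ (isClosed_eq (continuous_apply i) continuous_const)
    have : ((compatibleUpTo p j : Subgroup _) : Set (∀ i, X i))
        = ⋂ (l : ℕ) (_ : l < j), {x | p l (x (l + 1)) = x l} := by
      ext x; simp only [Set.mem_iInter]; rfl
    change IsClosed ((compatibleUpTo p j : Subgroup _) : Set (∀ i, X i))
    rw [this]
    exact isClosed_iInter fun l => isClosed_iInter fun _ => isClosed_eq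
      (continuous_of_discreteTopology.comp (continuous_apply (l + 1))) (continuous_apply l)
  obtain ⟨x, hx⟩ := IsCompact.nonempty_iInter_of_sequence_nonempty_isCompact_isClosed S
    (fun j x hx => ⟨compatibleUpTo_antitone p j.le_succ hx.1, hx.2⟩)
    (fun j => by
      have h1 : g ∈ (compatibleUpTo p (max n j)).map (Pi.evalMonoidHom X i) := by
        rw [hn _ (le_max_left _ _)]; exact hg
      obtain ⟨x, hx, e⟩ := h1
      exact ⟨x, compatibleUpTo_antitone p (le_max_right n j) hx, e⟩)
    (hS 0).isCompact hS
  rw [Set.mem_iInter] at hx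
  exact ⟨x, (hL x).2 fun l => (hx (l + 1)).1 l l.lt_succ_self, (hx 0).2⟩

/-- If the image of each transition map is contained in the subgroup generated by the commutators
and the image of `Γ`, the same holds for the limit modulo the kernel of each projection. -/
theorem range_sup_commutator_sup_ker_eq_top [∀ i, Finite (X i)] {L : Subgroup (∀ i, X i)}
    (hL : ∀ x, x ∈ L ↔ ∀ i, p i (x (i + 1)) = x i) {Γ : Type*} [Group Γ] (f : Γ →* L)
    (hp : ∀ j (t : X (j + 1)),
      p j t ∈ ((Pi.evalMonoidHom X j).comp (L.subtype.comp f)).range ⊔ commutator (X j))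
    (i : ℕ) :
    f.range ⊔ commutator L ⊔ ((Pi.evalMonoidHom X i).comp L.subtype).ker = ⊤ := by
  obtain ⟨n, hn⟩ := exists_map_compatibleUpTo_eq p hL i
  have hLT : ∀ j, L ≤ compatibleUpTo p j := fun j x hx l _ => (hL x).1 hx l
  -- At a level `j ≥ n, i`, the entry of `k` is the image of some `x` times a product `c` of
  -- commutators. Lift `c` to sequences compatible up to `j`; by the choice of `n`, the `i`-th entry
  -- of the lift also comes from some `d` in the commutator subgroup of `L`. Then `f x * d` agrees
  -- with `k` at `i`.
  refine top_le_iff.1 fun k _ => ?_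
  set j := max n i
  have hk : (k : ∀ i, X i) j = p j ((k : ∀ i, X i) (j + 1)) := ((hL k).1 k.2 j).symm
  obtain ⟨_, ⟨x, rfl⟩, c, hc, e⟩ := Subgroup.mem_sup_of_normal_right.1
    (hp j ((k : ∀ i, X i) (j + 1)))
  have htop : (compatibleUpTo p j).map (Pi.evalMonoidHom X j) = ⊤ :=
    top_le_iff.1 fun t _ => exists_mem_compatibleUpTo p j t
  rw [commutator_def, ← htop, ← Subgroup.map_commutator] at hc
  obtain ⟨c', hc', rfl⟩ := hc
  have h1 : Pi.evalMonoidHom X i c' ∈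
      ⁅compatibleUpTo p j, compatibleUpTo p j⁆.map (Pi.evalMonoidHom X i) := ⟨c', hc', rfl⟩
  rw [Subgroup.map_commutator, hn j (le_max_left _ _), ← Subgroup.map_commutator,
    ← Subgroup.map_subtype_commutator] at h1
  obtain ⟨_, ⟨d, hd, rfl⟩, hd'⟩ := h1
  have h2 : (k : ∀ i, X i) i = ((f x : L) : ∀ i, X i) i * c' i := by
    refine eq_of_mem_compatibleUpTo p (y := (f x : ∀ i, X i) * c') (hLT j k.2)
      ((compatibleUpTo p j).mul_mem (hLT j (f x).2) (Subgroup.commutator_le_self _ hc')) ?_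
      (le_max_right n i)
    rw [hk, ← e]; rfl
  rw [← mul_inv_cancel_left (f x * d) k]
  refine Subgroup.mul_mem_sup (Subgroup.mul_mem_sup ⟨x, rfl⟩ hd) ?_
  have hd'' : (d : ∀ i, X i) i = c' i := hd'
  change (((f x * d)⁻¹ * k : L) : ∀ i, X i) i = 1
  simp [h2, hd'']

end InverseSequence

/-! ### Free normal closures: functoriality, finiteness, image. -/

section FreeNormalClosure

variable {Γ : Type u} {G : Type v} [Group Γ] [Group G] (φ : Γ →* G)

/-- A normal map with a map from `φ` to it receives a map from the free normal closure of `φ`. -/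
theorem FreeNormalClosure.exists_lift {M Q : Type*} [Group M] [Group Q] {n : M →* Q}
    (S : NormalStructure n) (ψ : Γ →* M) (a : G →* Q) (h : n.comp ψ = a.comp φ) :
    ∃ f : FreeNormalClosure φ →* M, f.comp (ofDomain φ) = ψ := by
  let F : Copies Γ G →* M := Monoid.CoprodI.lift fun g => (S.act (a g)).toMonoidHom.comp ψ
  have F_copy : ∀ g x, F (copy Γ g x) = S.act (a g) (ψ x) := fun g x => by simp [F, copy]
  have hφ : ∀ x, n (ψ x) = a (φ x) := DFunLike.congr_fun h
  have nF : ∀ x, n (F x) = a (copiesMap φ x) := fun x =>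
    DFunLike.congr_fun (copies_hom_ext (f := n.comp F) (f' := a.comp (copiesMap φ)) fun g x => by
      simp [F_copy, S.equivariant, hφ]) x
  have F_shift : ∀ h x, F (shift Γ h x) = S.act (a h) (F x) := fun h x =>
    DFunLike.congr_fun (copies_hom_ext (f := F.comp (shift Γ h))
      (f' := (S.act (a h)).toMonoidHom.comp F) fun g x => by simp [F_copy]) x
  have hF : peifferSubgroup φ ≤ F.ker := by
    refine Subgroup.normalClosure_le_normal ?_
    rintro _ ⟨x, y, rfl⟩
    simp [MonoidHom.mem_ker, F_shift, ← nF, S.peiffer]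
  refine ⟨QuotientGroup.lift _ F hF, ?_⟩
  ext x
  exact (F_copy 1 x).trans (by simp)

/-- The image of the copy `Γ_g` in the free normal closure. -/
def FreeNormalClosure.ofCopy (g : G) : Γ →* FreeNormalClosure φ :=
  (QuotientGroup.mk' (peifferSubgroup φ)).comp (copy Γ g)

theorem FreeNormalClosure.mem_of_forall_ofCopy_mem {S : Subgroup (FreeNormalClosure φ)}
    (hS : ∀ g x, ofCopy φ g x ∈ S) (m : FreeNormalClosure φ) : m ∈ S := by
  obtain ⟨m, rfl⟩ := QuotientGroup.mk'_surjective _ m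
  induction m using Monoid.CoprodI.induction_on with
  | one => exact S.one_mem
  | of g x => exact hS g x
  | mul x y hx hy => exact S.mul_mem hx hy

/-- For `n m = 1` the Peiffer identity says that conjugation by `m` is trivial. -/
theorem NormalStructure.ker_le_center {M : Type u} {G : Type v} [Group M] [Group G] {n : M →* G}
    (S : NormalStructure n) : n.ker ≤ Subgroup.center M := fun m hm => by
  rw [Subgroup.mem_center_iff]
  intro g
  have h := S.peiffer m g
  rw [MonoidHom.mem_ker.1 hm, map_one, MulAut.one_apply] at h
  nth_rw 1 [h]
  group

/-- The kernel over the finite group `G` is central, so the commutator subgroup is finite. The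
abelianization is generated by finitely many elements of finite order. -/
instance FreeNormalClosure.finite [Finite Γ] [Finite G] : Finite (FreeNormalClosure φ) := by
  have := finite_commutatorSet_of_ker_le_center (toCodomain φ)
    (normalStructure φ).ker_le_center
  have hfg : Group.FG (FreeNormalClosure φ) :=
    ⟨(Set.finite_range fun q : G × Γ => ofCopy φ q.1 q.2).toFinset, by
      rw [Set.Finite.coe_toFinset]
      refine top_le_iff.1 fun m _ => mem_of_forall_ofCopy_mem φ (fun g x => ?_) m
      exact Subgroup.subset_closure ⟨(g, x), rfl⟩⟩
  have : Group.FG (Abelianization (FreeNormalClosure φ)) :=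
    Group.fg_of_surjective (f := Abelianization.of) (QuotientGroup.mk'_surjective _)
  have htor : ∀ m : FreeNormalClosure φ,
      m ∈ (CommGroup.torsion (Abelianization (FreeNormalClosure φ))).comap Abelianization.of :=
    mem_of_forall_ofCopy_mem φ fun g x =>
      (Abelianization.of.comp (ofCopy φ g)).isOfFinOrder (isOfFinOrder_of_finite x)
  have : Finite (Abelianization (FreeNormalClosure φ)) :=
    CommGroup.finite_of_fg_isMulTorsion _ fun a => by
      obtain ⟨m, rfl⟩ := QuotientGroup.mk'_surjective _ a
      exact htor m
  have : Finite (FreeNormalClosure φ ⧸ commutator (FreeNormalClosure φ)) := this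
  exact Finite.of_subgroup_quotient (commutator (FreeNormalClosure φ))

theorem FreeNormalClosure.toCodomain_mem_range_sup_commutator (t : FreeNormalClosure φ) :
    toCodomain φ t ∈ φ.range ⊔ commutator G := by
  refine mem_of_forall_ofCopy_mem φ
    (S := (φ.range ⊔ commutator G).comap (toCodomain φ)) (fun g x => ?_) t
  change copiesMap φ (copy Γ g x) ∈ φ.range ⊔ commutator G
  rw [copiesMap_copy, sup_comm, ← inv_mul_cancel_right (g * φ x * g⁻¹) (φ x)]
  exact Subgroup.mul_mem_sup
    (Subgroup.commutator_mem_commutator (Subgroup.mem_top g) (Subgroup.mem_top (φ x))) ⟨x, rfl⟩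

end FreeNormalClosure

/-! ### The tower and its limit. -/

section Tower

/-- The crossed module `Γ/γ_{i+2} → Γ/γ_{i+1}`, with the action induced by conjugation. -/
def lowerCentralNormalStructure (Γ : Type u) [Group Γ] (i : ℕ) :
    NormalStructure (QuotientGroup.map ((⊤ : Subgroup Γ).lowerCentralSeries (i + 1))
      ((⊤ : Subgroup Γ).lowerCentralSeries i) (MonoidHom.id Γ)
      (Subgroup.lowerCentralSeries_antitone _ i.le_succ)) where
  -- Conjugation descends because the `i`-th term is central modulo the next one.
  act := QuotientGroup.lift _ (MulAut.conj.comp (QuotientGroup.mk' _)) fun x hx => by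
    ext y
    obtain ⟨y, rfl⟩ := QuotientGroup.mk'_surjective _ y
    rw [MonoidHom.comp_apply, MulAut.conj_apply, MulAut.one_apply, mul_inv_eq_iff_eq_mul,
      ← commutatorElement_eq_one_iff_mul_comm, ← map_commutatorElement]
    exact (QuotientGroup.eq_one_iff _).2
      (Subgroup.commutator_mem_commutator hx (Subgroup.mem_top y))
  equivariant := fun g m => by
    obtain ⟨g, rfl⟩ := QuotientGroup.mk'_surjective _ g
    obtain ⟨m, rfl⟩ := QuotientGroup.mk'_surjective _ m
    rfl
  peiffer := fun m m' => by
    obtain ⟨m, rfl⟩ := QuotientGroup.mk'_surjective _ m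
    rfl

variable {Γ G : Type u} [Group Γ] [Group G] (φ : Γ →* G)

theorem exists_tower_lift (i : ℕ) :
    ∃ f : (tower φ i).carrier →* Γ ⧸ (⊤ : Subgroup Γ).lowerCentralSeries i,
      f.comp (tower φ i).hom = QuotientGroup.mk' _ := by
  induction i with
  | zero =>
    -- The series starts at index `0` with the whole group, so the target is trivial.
    refine ⟨1, MonoidHom.ext fun x => ?_⟩
    exact ((QuotientGroup.eq_one_iff x).2 (Subgroup.mem_top x)).symm
  | succ i ih =>
    obtain ⟨a, ha⟩ := ih
    exact FreeNormalClosure.exists_lift (tower φ i).hom (lowerCentralNormalStructure Γ i)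
      (QuotientGroup.mk' _) a (by rw [ha]; rfl)

theorem lowerCentralSeries_quotient_eq_bot (H : Type*) [Group H] (i : ℕ) :
    (⊤ : Subgroup (H ⧸ (⊤ : Subgroup H).lowerCentralSeries i)).lowerCentralSeries i = ⊥ := by
  rw [← Subgroup.map_top_of_surjective _ (QuotientGroup.mk'_surjective
    ((⊤ : Subgroup H).lowerCentralSeries i)), ← Subgroup.map_lowerCentralSeries,
    Subgroup.map_eq_bot_iff, QuotientGroup.ker_mk']

/-- Project to level `k - 1` of the tower and map on to `Γ/γ_k`, whose own `γ_k` is trivial. -/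
theorem mem_gammaSeries_of_homInfty_mem {k : ℕ} {x : Γ}
    (hx : homInfty φ x ∈ gammaSeries (GammaInfty φ) k) : x ∈ gammaSeries Γ k := by
  obtain ⟨f, hf⟩ := exists_tower_lift φ (k - 1)
  have h : f ((tower φ (k - 1)).hom x) ∈
      (⊤ : Subgroup (Γ ⧸ (⊤ : Subgroup Γ).lowerCentralSeries (k - 1))).lowerCentralSeries (k - 1) :=
    gammaSeries_le_comap
      (f.comp ((Pi.evalMonoidHom _ (k - 1)).comp (towerLimit φ).subtype)) k hx
  rw [lowerCentralSeries_quotient_eq_bot, Subgroup.mem_bot, ← MonoidHom.comp_apply, hf] at h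
  exact (QuotientGroup.eq_one_iff x).1 h

theorem finite_tower [Finite Γ] [Finite G] (i : ℕ) : Finite (tower φ i).carrier := by
  induction i with
  | zero => assumption
  | succ i ih => exact FreeNormalClosure.finite (tower φ i).hom

theorem range_homInfty_sup_commutator_eq_top [Finite Γ] [Finite G] :
    (homInfty φ).range ⊔ commutator (GammaInfty φ) = ⊤ := by
  have := finite_tower φ
  let _ : ∀ i, TopologicalSpace (tower φ i).carrier := fun _ => ⊥
  have : ∀ i, DiscreteTopology (tower φ i).carrier := fun _ => ⟨rfl⟩
  have hclosed : IsClosed (towerLimit φ : Set (∀ i, (tower φ i).carrier)) := by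
    have : (towerLimit φ : Set (∀ i, (tower φ i).carrier))
        = ⋂ i, {x | towerMap φ i (x (i + 1)) = x i} := by
      ext x; simp only [Set.mem_iInter]; rfl
    rw [this]
    exact isClosed_iInter fun i => isClosed_eq
      (continuous_of_discreteTopology.comp (continuous_apply (i + 1))) (continuous_apply i)
  have : CompactSpace (GammaInfty φ) := isCompact_iff_compactSpace.1 hclosed.isCompact
  let ev : ∀ i, GammaInfty φ →* (tower φ i).carrier := fun i =>
    (Pi.evalMonoidHom _ i).comp (towerLimit φ).subtype
  have hev : ∀ i x, towerMap φ i (ev (i + 1) x) = ev i x := fun i x => x.2 i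
  have hevc : ∀ i, Continuous (ev i) := fun i => (continuous_apply i).comp continuous_subtype_val
  have : Finite (homInfty φ).range := Set.finite_range _
  refine sup_commutator_eq_top_of_compactSpace (homInfty φ).range (U := fun i => (ev i).ker)
    (fun i => inferInstance) (fun i => (isOpen_discrete {1}).preimage (hevc i)) ?_ ?_ ?_ ?_
  · refine antitone_nat_of_succ_le fun i x hx => ?_
    rw [MonoidHom.mem_ker] at hx ⊢
    rw [← hev, hx, map_one]
  -- An element trivial at level `i` lies at level `i + 1` in the kernel of a crossed module, hence
  -- in the center.
  · intro i
    rw [Subgroup.commutator_le]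
    intro x hx y _
    have h1 : ev (i + 1) x ∈ (towerMap φ i).ker := (hev i x).trans hx
    have h2 := (FreeNormalClosure.normalStructure (tower φ i).hom).ker_le_center h1
    rw [MonoidHom.mem_ker, map_commutatorElement, commutatorElement_eq_one_iff_mul_comm]
    exact (Subgroup.mem_center_iff.1 h2 _).symm
  · refine eq_bot_iff.2 fun x hx => ?_
    rw [Subgroup.mem_iInf] at hx
    exact Subtype.ext (funext fun i => hx i)
  · exact range_sup_commutator_sup_ker_eq_top (towerMap φ) (L := towerLimit φ) (fun x => Iff.rfl)
      (homInfty φ) fun j t =>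
        FreeNormalClosure.toCodomain_mem_range_sup_commutator (tower φ j).hom t

end Tower

/-! ### Induced maps on lower central quotients. -/

section Gamma

theorem gammaSeries_antitone (H : Type u) [Group H] : Antitone (gammaSeries H) :=
  fun _ _ h => Subgroup.lowerCentralSeries_antitone _ (Nat.sub_le_sub_right h 1)

theorem gammaQuotientMap_injective {A : Type u} {B : Type v} [Group A] [Group B] {f : A →* B}
    {k : ℕ} (h : ∀ x, f x ∈ gammaSeries B k → x ∈ gammaSeries A k) :
    Function.Injective (gammaQuotientMap f k) := by
  rw [injective_iff_map_eq_one]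
  intro a ha
  obtain ⟨x, rfl⟩ := QuotientGroup.mk'_surjective _ a
  exact (QuotientGroup.eq_one_iff x).2 (h x ((QuotientGroup.eq_one_iff (f x)).1 ha))

theorem gammaResidualQuotientMap_injective {A : Type u} {B : Type v} [Group A] [Group B]
    {f : A →* B} (h : ∀ x, f x ∈ gammaResidual B → x ∈ gammaResidual A) :
    Function.Injective (gammaResidualQuotientMap f) := by
  rw [injective_iff_map_eq_one]
  intro a ha
  obtain ⟨x, rfl⟩ := QuotientGroup.mk'_surjective _ a
  exact (QuotientGroup.eq_one_iff x).2 (h x ((QuotientGroup.eq_one_iff (f x)).1 ha))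

theorem map_surjective_of_range_sup_eq_top {A B : Type*} [Group A] [Group B] (f : A →* B)
    {M : Subgroup A} {N : Subgroup B} [M.Normal] [N.Normal] (hMN : M ≤ N.comap f)
    (h : f.range ⊔ N = ⊤) : Function.Surjective (QuotientGroup.map M N f hMN) := by
  intro b
  obtain ⟨b, rfl⟩ := QuotientGroup.mk'_surjective _ b
  obtain ⟨_, ⟨x, rfl⟩, n, hn, rfl⟩ := Subgroup.mem_sup_of_normal_right.1 (h ▸ Subgroup.mem_top b)
  refine ⟨QuotientGroup.mk' _ x, ?_⟩
  exact QuotientGroup.eq.2 (by simpa using hn)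

end Gamma

end SubnormalClosure

open SubnormalClosure

theorem mainTheorem5 {Γ G : Type u} [Group Γ] [Group G] (φ : Γ →* G) :
    (∀ k : ℕ, 1 ≤ k →
      Function.Injective
        (SubnormalClosure.gammaQuotientMap (SubnormalClosure.homInfty φ) k)) ∧
    (Finite Γ → Finite G →
      (∀ k : ℕ, 1 ≤ k →
        Function.Bijective
          (SubnormalClosure.gammaQuotientMap (SubnormalClosure.homInfty φ) k)) ∧
      SubnormalClosure.GammaTerminatesAt Γ (SubnormalClosure.gammaResidual Γ) ∧
      SubnormalClosure.GammaTerminatesAt (SubnormalClosure.GammaInfty φ)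
        (SubnormalClosure.gammaResidual (SubnormalClosure.GammaInfty φ)) ∧
      Function.Bijective
        (SubnormalClosure.gammaResidualQuotientMap (SubnormalClosure.homInfty φ))) := by
  have hinj : ∀ k x, homInfty φ x ∈ gammaSeries (GammaInfty φ) k → x ∈ gammaSeries Γ k :=
    fun k x => mem_gammaSeries_of_homInfty_mem φ
  refine ⟨fun k _ => gammaQuotientMap_injective (hinj k), fun _ _ => ?_⟩
  have hsup : ∀ k, (homInfty φ).range ⊔ gammaSeries (GammaInfty φ) k = ⊤ := fun k =>
    sup_lowerCentralSeries_eq_top (range_homInfty_sup_commutator_eq_top φ) (k - 1)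
  obtain ⟨t, ht⟩ := exists_forall_ge_eq_of_antitone (gammaSeries_antitone Γ)
  have hΓ : GammaTerminatesAt Γ (gammaSeries Γ t) :=
    ⟨t + 1, by omega, fun s hs => ht s (by omega)⟩
  -- The series of the limit stops where that of `Γ` does. For `s > t`, write `y` in `γ_t` as the
  -- image of `x` times `z` in `γ_s`. The image of `x` is then in `γ_t`, so `x` lies in `γ_t(Γ) =
  -- γ_s(Γ)` by injectivity, and `y` is in `γ_s`.
  have hK : GammaTerminatesAt (GammaInfty φ) (gammaSeries (GammaInfty φ) t) := by
    refine ⟨t + 1, by omega, fun s hs => le_antisymm (gammaSeries_antitone _ (by omega)) ?_⟩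
    intro y hy
    obtain ⟨_, ⟨x, rfl⟩, z, hz, rfl⟩ :=
      Subgroup.mem_sup_of_normal_right.1 (hsup s ▸ Subgroup.mem_top y)
    have hx : homInfty φ x ∈ gammaSeries (GammaInfty φ) t :=
      (Subgroup.mul_mem_cancel_right _ (gammaSeries_antitone _ (by omega : t ≤ s) hz)).1 hy
    have hx' : x ∈ gammaSeries Γ s := by
      rw [ht s (by omega)]; exact hinj t x hx
    exact Subgroup.mul_mem _ (gammaSeries_le_comap (homInfty φ) s hx') hz
  refine ⟨fun k _ => ⟨gammaQuotientMap_injective (hinj k),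
    map_surjective_of_range_sup_eq_top _ _ (hsup k)⟩, ?_, ?_, ?_, ?_⟩
  · rw [hΓ.eq_gammaResidual]; exact hΓ
  · rw [hK.eq_gammaResidual]; exact hK
  · refine gammaResidualQuotientMap_injective ?_
    rw [hΓ.eq_gammaResidual, hK.eq_gammaResidual]
    exact hinj t
  · refine map_surjective_of_range_sup_eq_top _ _ ?_
    rw [hK.eq_gammaResidual]
    exact hsup t
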